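/- **Model.** A base station serves $M\ge 1$ clients. Time is slotted, and $T\ge 1$ consecutive slots form a frame. At the beginning of every frame $k=1,2,\dots$ a new packet is generated for every client, and it replaces any undelivered packet of that client. In each slot the base station either idles or transmits to one client whose packet of the current frame is still undelivered; a transmission to client $i$ succeeds with probability $p_i\in(0,1]$, independently of the past, and its success or failure is observed immediately. Let $\Pi$ be the class of non-anticipative policies: in each slot the choice is made, possibly at random, on the basis of the past choices and their observed outcomes. Client $i$ has a weight $\alpha_i>0$. Let $h_{k,i}$ be the number of frames since the last delivery to client $i$: the initial values $h_{1,i}$ are given positive integers, $h_{k+1,i}=1$ if client $i$ receives a packet during frame $k$, and $h_{k+1,i}=h_{k,i}+1$ otherwise. The performance of a policy $\pi\in\Pi$ over $K$ frames is $$\mathbb E[J_K^{\pi}],\qquad J_K^{\pi}=\frac1{KM}\sum_{k=1}^{K}\sum_{i=1}^{M}\alpha_i h_{k,i},$$ and the optimal performance is $\mathbb E[J_K^{*}]=\inf_{\eta\in\Pi}\mathbb E[J_K^{\eta}]$. A *Max-Weight policy* transmits, in each slot of frame $k$, to a client with the highest value of $p_i\alpha_i h_{k,i}(h_{k,i}+2)$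 among the clients with an undelivered packet, ties being broken arbitrarily; it idles only when all packets of the frame have been delivered. **Theorem (Performance of Max-Weight).** Let $$\rho^{MW}=4\,\frac{\left(\sum_{i=1}^{M}\sqrt{\alpha_i/p_i}\right)^2+(T-1)\sum_{i=1}^{M}\alpha_i/p_i}{\left(\sum_{i=1}^{M}\sqrt{\alpha_i/p_i}\right)^2+T\sum_{i=1}^{M}\alpha_i}.$$ For every such network and all initial values, every Max-Weight policy $MW$ is $\rho^{MW}$-optimal in the infinite-horizon limit, that is, $$\limsup_{K\to\infty}\frac{\mathbb E[J_K^{MW}]}{\mathbb E[J_K^{*}]}\le\rho^{MW}\qquad\text{and}\qquad \limsup_{K\to\infty}\mathbb E[J_K^{MW}]\le\rho^{MW}\,\liminf_{K\to\infty}\mathbb E[J_K^{*}].$$ -/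

import Mathlib

open Filter
open scoped ENNReal

noncomputable section

namespace AoI

/-- A broadcast network: `M` clients, frames of `T` slots, channel reliabilities `p i ∈ (0, 1]`,
client weights `α i > 0`. -/
structure Network where
  M : ℕ
  T : ℕ
  p : Fin M → ℝ
  α : Fin M → ℝ
  M_pos : 0 < M
  T_pos : 0 < T
  p_pos : ∀ i, 0 < p i
  p_le_one : ∀ i, p i ≤ 1
  α_pos : ∀ i, 0 < α i

/-- What the base station sees in one slot: the selected client (`none` means that it idles), and
the feedback (`true` iff a packet was delivered in the slot). -/
abbrev Slot (N : Network) : Type := Option (Fin N.M) × Bool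

/-- The record of the elapsed slots, in chronological order. Frames are numbered from `0`: frame `k`
consists of the slots number `k * T, …, k * T + T - 1`. If `H.length` slots have elapsed, the coming
slot belongs to frame `H.length / T`. -/
abbrev History (N : Network) : Type := List (Slot N)

variable {N : Network}

/-- The history `H` contains a delivery to client `i` in frame `k`. -/
def Delivered (H : History N) (k : ℕ) (i : Fin N.M) : Prop :=
  (some i, true) ∈ (H.drop (k * N.T)).take N.T

/-- Client `i` has not yet received its packet of the frame to which the coming slot belongs. -/
def Undelivered (H : History N) (i : Fin N.M) : Prop :=
  ¬ Delivered H (H.length / N.T) i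

open Classical in
/-- `age h₁ H k i` is the number of frames since the last delivery to client `i`, at the beginning
of frame `k`, where `h₁` is the vector of initial values (at the beginning of frame `0`). -/
def age (h₁ : Fin N.M → ℕ) (H : History N) : ℕ → Fin N.M → ℕ
  | 0, i => h₁ i
  | k + 1, i => if Delivered H k i then 1 else age h₁ H k i + 1

variable (N) in
/-- A non-anticipative, possibly randomized, scheduling policy: given the history, it draws a client
with an undelivered packet, or idles. -/
structure Policy where
  act : History N → PMF (Option (Fin N.M))
  admissible : ∀ (H : History N) (i : Fin N.M), some i ∈ (act H).support → Undelivered H i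

variable (N) in
/-- The feedback of a transmission over a channel of reliability `q`: a success (`true`) with
probability `q`, a failure (`false`) with probability `1 - q`. -/
def feedback (q : ℝ) (h0 : 0 ≤ q) (h1 : q ≤ 1) : PMF Bool :=
  PMF.ofFintype (fun b => if b then ENNReal.ofReal q else ENNReal.ofReal (1 - q)) (by
    simp [← ENNReal.ofReal_add h0 (sub_nonneg.2 h1)])

variable (N) in
/-- The outcome of a slot in which `a` is chosen: a transmission to client `i` is successful with
probability `p i`, independently of the past. -/
def outcome : Option (Fin N.M) → PMF (Slot N)
  | none => PMF.pure (none, false)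
  | some i => (feedback (N.p i) (N.p_pos i).le (N.p_le_one i)).map fun b => (some i, b)

/-- The law of the history of the first `n` slots under the policy `π`. -/
def Policy.law (π : Policy N) : ℕ → PMF (History N)
  | 0 => PMF.pure []
  | n + 1 =>
    (π.law n).bind fun H => (π.act H).bind fun a => (outcome N a).map fun s => H ++ [s]

/-- `J_K = (1 / (K M)) ∑_k ∑_i α_i h_{k,i}`, the sum being over the first `K` frames. -/
def weightedAge (h₁ : Fin N.M → ℕ) (K : ℕ) (H : History N) : ℝ :=
  1 / ((K : ℝ) * (N.M : ℝ)) * ∑ k ∈ Finset.range K, ∑ i, N.α i * (age h₁ H k i : ℝ)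

/-- The expectation `E[J_K^π]`, given the initial values `h₁`. -/
def Policy.cost (π : Policy N) (h₁ : Fin N.M → ℕ) (K : ℕ) : ℝ≥0∞ :=
  ∑' H : History N, π.law (K * N.T) H * ENNReal.ofReal (weightedAge h₁ K H)

/-- The optimal performance over the horizon of `K` frames. -/
def optimalCost (h₁ : Fin N.M → ℕ) (K : ℕ) : ℝ≥0∞ :=
  ⨅ η : Policy N, η.cost h₁ K

/-- The policy `π` is `ρ`-optimal in the infinite-horizon limit: its optimality ratio
`E[J_K^π] / E[J_K^*]` is asymptotically at most `ρ`, and its long-run performance is at most `ρ`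
times the optimal long-run performance. No limit is assumed to exist: the performance of `π` is
measured by the upper limit and the optimal one by the lower limit. -/
def Policy.IsOptimalUpTo (π : Policy N) (h₁ : Fin N.M → ℕ) (ρ : ℝ) : Prop :=
  limsup (fun K : ℕ => π.cost h₁ K / optimalCost h₁ K) atTop ≤ ENNReal.ofReal ρ ∧
  limsup (fun K : ℕ => π.cost h₁ K) atTop
    ≤ ENNReal.ofReal ρ * liminf (fun K : ℕ => optimalCost (N := N) h₁ K) atTop

/-- The Max-Weight priority `p_i α_i h (h + 2)` of client `i`, where `h` is its age in the frame to
which the coming slot belongs. -/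
def priority (h₁ : Fin N.M → ℕ) (H : History N) (i : Fin N.M) : ℝ :=
  N.p i * N.α i * (age h₁ H (H.length / N.T) i : ℝ) * ((age h₁ H (H.length / N.T) i : ℝ) + 2)

/-- `π` is a Max-Weight policy: in each slot it selects, among the clients with an undelivered
packet, one of the highest priority (ties being broken in any way, possibly at random and depending
on the history), and it idles only when there is no such client. -/
def Policy.IsMaxWeight (π : Policy N) (h₁ : Fin N.M → ℕ) : Prop :=
  ∀ H : History N,
    (∀ i, some i ∈ (π.act H).support →
      ∀ j, Undelivered H j → priority h₁ H j ≤ priority h₁ H i) ∧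
    (none ∈ (π.act H).support → ∀ j, ¬ Undelivered H j)

end AoI

end

/-! Write `s i = √(α i / p i)` and `S = ∑ s i`. The ratio compares a lower bound valid for every
policy with an upper bound for Max-Weight.

Lower bound: a Lagrangian relaxation. Each delivery to `i` is charged a price inversely proportional
to `p i`, so that a transmission has the same expected price for every client. The total charge is
bounded through the number of slots (`mean_sum_count_le`), and a quadratic potential bounds age plus
charge from below, client by client (`sum_age_ge`).

Upper bound: a drift argument for `∑ α h²`. A delivery lowers the next value by `α h (h + 2)`, so
Max-Weight is greedy for the expected decrease. It therefore does at least as well as any fractional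
division of a frame's slots, each client getting at most one (`iterate_stepMean_lyapunov_le`).
Comparison with the division `frameShare` bounds the drift by minus twice the weighted age plus a
constant (`frame_drift`); telescoping bounds the average age.

Initial values contribute only `O(1 / K)`, which vanishes in the limit. -/

noncomputable section

namespace AoI

variable {N : Network}

/-! ### Real-valued expectations -/

/-- The mean of `g` over the outcome of a slot in which `a` is chosen. -/
def outcomeMean (g : Slot N → ℝ) : Option (Fin N.M) → ℝ
  | none => g (none, false)
  | some i => N.p i * g (some i, true) + (1 - N.p i) * g (some i, false)

/-- The conditional mean of `f`, one slot ahead, given the history. -/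
def Policy.stepMean (π : Policy N) (f : History N → ℝ) (H : History N) : ℝ :=
  ∑ a, (π.act H a).toReal * outcomeMean (fun s => f (H ++ [s])) a

/-- The mean of `f` over the history of the first `n` slots. -/
def Policy.mean (π : Policy N) (n : ℕ) (f : History N → ℝ) : ℝ :=
  π.stepMean^[n] f []

theorem outcomeMean_mono {g g' : Slot N → ℝ} (h : ∀ s, g s ≤ g' s) (a : Option (Fin N.M)) :
    outcomeMean g a ≤ outcomeMean g' a := by
  cases a with
  | none => exact h _
  | some i =>
    exact add_le_add (mul_le_mul_of_nonneg_left (h _) (N.p_pos i).le)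
      (mul_le_mul_of_nonneg_left (h _) (sub_nonneg.2 (N.p_le_one i)))

theorem outcomeMean_add (g g' : Slot N → ℝ) (a : Option (Fin N.M)) :
    outcomeMean (fun s => g s + g' s) a = outcomeMean g a + outcomeMean g' a := by
  cases a with
  | none => rfl
  | some i => simp only [outcomeMean]; ring

theorem outcomeMean_mul_const (g : Slot N → ℝ) (c : ℝ) (a : Option (Fin N.M)) :
    outcomeMean (fun s => c * g s) a = c * outcomeMean g a := by
  cases a with
  | none => rfl
  | some i => simp only [outcomeMean]; ring

theorem Policy.sum_act (π : Policy N) (H : History N) : ∑ a, (π.act H a).toReal = 1 := by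
  rw [← ENNReal.toReal_sum fun a _ => (π.act H).apply_ne_top a, ← tsum_fintype (L := .unconditional _),
    (π.act H).tsum_coe, ENNReal.toReal_one]

theorem Policy.stepMean_le_of_support (π : Policy N) {f : History N → ℝ} {H : History N} {c : ℝ}
    (h : ∀ a ∈ (π.act H).support, outcomeMean (fun s => f (H ++ [s])) a ≤ c) :
    π.stepMean f H ≤ c := by
  calc π.stepMean f H ≤ ∑ a, (π.act H a).toReal * c := by
        refine Finset.sum_le_sum fun a _ => ?_
        by_cases ha : a ∈ (π.act H).support
        · exact mul_le_mul_of_nonneg_left (h a ha) ENNReal.toReal_nonneg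
        · rw [PMF.mem_support_iff, not_not] at ha
          simp [ha]
    _ = c := by rw [← Finset.sum_mul, π.sum_act, one_mul]

theorem Policy.stepMean_mono (π : Policy N) {f g : History N → ℝ} {H : History N}
    (h : ∀ s, f (H ++ [s]) ≤ g (H ++ [s])) : π.stepMean f H ≤ π.stepMean g H :=
  Finset.sum_le_sum fun a _ =>
    mul_le_mul_of_nonneg_left (outcomeMean_mono h a) ENNReal.toReal_nonneg

theorem Policy.stepMean_add (π : Policy N) (f g : History N → ℝ) (H : History N) :
    π.stepMean (fun H => f H + g H) H = π.stepMean f H + π.stepMean g H := by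
  simp only [stepMean, outcomeMean_add, mul_add, Finset.sum_add_distrib]

theorem Policy.stepMean_const (π : Policy N) (c : ℝ) (H : History N) :
    π.stepMean (fun _ => c) H = c := by
  have : ∀ a, outcomeMean (N := N) (fun _ => c) a = c := fun a => by
    cases a with
    | none => rfl
    | some i => simp only [outcomeMean]; ring
  simp only [stepMean, this]
  rw [← Finset.sum_mul, π.sum_act, one_mul]

theorem Policy.stepMean_const_mul (π : Policy N) (f : History N → ℝ) (c : ℝ) (H : History N) :
    π.stepMean (fun H => c * f H) H = c * π.stepMean f H := by
  simp only [stepMean, outcomeMean_mul_const, Finset.mul_sum]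
  exact Finset.sum_congr rfl fun a _ => by ring

theorem Policy.iterate_stepMean_mono (π : Policy N) (n : ℕ) {f g : History N → ℝ} {H : History N}
    (h : ∀ H', H'.length = H.length + n → f H' ≤ g H') :
    π.stepMean^[n] f H ≤ π.stepMean^[n] g H := by
  induction n generalizing H with
  | zero => exact h H rfl
  | succ n ih =>
    rw [Function.iterate_succ_apply', Function.iterate_succ_apply']
    refine π.stepMean_mono fun s => ih fun H' hH' => h H' ?_
    rw [hH', List.length_append, List.length_singleton]
    omega

/-- A term that is already determined by the history can be taken out of a conditional mean. -/
theorem Policy.iterate_stepMean_add (π : Policy N) (n : ℕ) (f g : History N → ℝ) (H : History N)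
    (h : ∀ H', g (H ++ H') = g H) :
    π.stepMean^[n] (fun H => f H + g H) H = π.stepMean^[n] f H + g H := by
  induction n generalizing H with
  | zero => rfl
  | succ n ih =>
    rw [Function.iterate_succ_apply', Function.iterate_succ_apply',
      ← π.stepMean_const (g H) H, ← π.stepMean_add]
    have : ∀ s, π.stepMean^[n] (fun H => f H + g H) (H ++ [s])
        = π.stepMean^[n] f (H ++ [s]) + g H := fun s => by
      rw [ih (H ++ [s]) fun H' => by rw [List.append_assoc, h, h], h]
    simp only [stepMean, this]

theorem Policy.mean_mono (π : Policy N) (n : ℕ) {f g : History N → ℝ}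
    (h : ∀ H, H.length = n → f H ≤ g H) : π.mean n f ≤ π.mean n g :=
  π.iterate_stepMean_mono n fun H' hH' => h H' (by simpa using hH')

theorem Policy.mean_add_const (π : Policy N) (n : ℕ) (f : History N → ℝ) (c : ℝ) :
    π.mean n (fun H => f H + c) = π.mean n f + c :=
  π.iterate_stepMean_add n f (fun _ => c) [] fun _ => rfl

theorem Policy.mean_const (π : Policy N) (n : ℕ) (c : ℝ) : π.mean n (fun _ => c) = c := by
  rw [mean, Function.iterate_fixed (funext fun H => π.stepMean_const c H)]

theorem Policy.mean_const_mul (π : Policy N) (n : ℕ) (f : History N → ℝ) (c : ℝ) :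
    π.mean n (fun H => c * f H) = c * π.mean n f := by
  unfold mean
  induction n generalizing f with
  | zero => rfl
  | succ n ih =>
    rw [Function.iterate_succ_apply, Function.iterate_succ_apply, ← ih]
    exact congrArg (fun g => π.stepMean^[n] g []) (funext fun H => π.stepMean_const_mul f c H)

theorem Policy.mean_add_fun (π : Policy N) (n : ℕ) (f g : History N → ℝ) :
    π.mean n (fun H => f H + g H) = π.mean n f + π.mean n g := by
  unfold mean
  induction n generalizing f g with
  | zero => rfl
  | succ n ih =>
    rw [Function.iterate_succ_apply, Function.iterate_succ_apply, Function.iterate_succ_apply, ← ih]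
    exact congrArg (fun g => π.stepMean^[n] g []) (funext fun H => π.stepMean_add f g H)

theorem Policy.mean_add (π : Policy N) (m n : ℕ) (f : History N → ℝ) :
    π.mean (m + n) f = π.mean m (π.stepMean^[n] f) := by
  rw [mean, Function.iterate_add_apply, mean]

/-! ### The expected cost as a real number -/

theorem tsum_bind_mul {β γ : Type*} (q : PMF β) (r : β → PMF γ) (g : γ → ℝ≥0∞) :
    ∑' c, q.bind r c * g c = ∑' b, q b * ∑' c, r b c * g c := by
  simp only [PMF.bind_apply, ← ENNReal.tsum_mul_right, ← ENNReal.tsum_mul_left]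
  rw [ENNReal.tsum_comm]
  exact tsum_congr fun b => tsum_congr fun c => mul_assoc _ _ _

theorem tsum_pure_mul {γ : Type*} (c : γ) (g : γ → ℝ≥0∞) : ∑' x, PMF.pure c x * g x = g c := by
  rw [tsum_eq_single c fun b hb => by simp [PMF.pure_apply, hb]]
  simp

theorem tsum_map_mul {β γ : Type*} (q : PMF β) (φ : β → γ) (g : γ → ℝ≥0∞) :
    ∑' c, q.map φ c * g c = ∑' b, q b * g (φ b) := by
  simp only [PMF.map, tsum_bind_mul, Function.comp_apply, tsum_pure_mul]

theorem outcomeMean_nonneg {g : Slot N → ℝ} (h : ∀ s, 0 ≤ g s) (a : Option (Fin N.M)) :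
    0 ≤ outcomeMean g a := by
  have := outcomeMean_mono (g := fun _ => 0) h a
  cases a <;> simpa [outcomeMean] using this

theorem tsum_outcome_mul {g : Slot N → ℝ} (h : ∀ s, 0 ≤ g s) (a : Option (Fin N.M)) :
    ∑' s, outcome N a s * ENNReal.ofReal (g s) = ENNReal.ofReal (outcomeMean g a) := by
  cases a with
  | none => exact tsum_pure_mul _ _
  | some i =>
    have h1 := sub_nonneg.2 (N.p_le_one i)
    rw [outcome, tsum_map_mul, tsum_fintype, Fintype.sum_bool, outcomeMean,
      ENNReal.ofReal_add (mul_nonneg (N.p_pos i).le (h _)) (mul_nonneg h1 (h _)),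
      ENNReal.ofReal_mul (N.p_pos i).le, ENNReal.ofReal_mul h1]
    rfl

/-- The law is built forwards and the mean backwards; conditioning on all but the last slot
reconciles them. Nonnegativity allows the passage to `ℝ≥0∞`. -/
theorem Policy.tsum_law_mul (π : Policy N) (n : ℕ) {f : History N → ℝ} (h : ∀ H, 0 ≤ f H) :
    ∑' H, π.law n H * ENNReal.ofReal (f H) = ENNReal.ofReal (π.mean n f) := by
  induction n generalizing f with
  | zero => exact tsum_pure_mul _ _
  | succ n ih =>
    have h0 : ∀ H, 0 ≤ π.stepMean f H := fun H =>
      Finset.sum_nonneg fun a _ =>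
        mul_nonneg ENNReal.toReal_nonneg (outcomeMean_nonneg (fun _ => h _) a)
    rw [mean, Function.iterate_succ_apply, ← mean, ← ih h0]
    simp only [law, tsum_bind_mul, tsum_map_mul]
    refine tsum_congr fun H => congrArg _ ?_
    rw [tsum_fintype, stepMean, ENNReal.ofReal_sum_of_nonneg fun a _ =>
      mul_nonneg ENNReal.toReal_nonneg (outcomeMean_nonneg (fun _ => h _) a)]
    refine Finset.sum_congr rfl fun a _ => ?_
    rw [tsum_outcome_mul fun s => h (H ++ [s]), ENNReal.ofReal_mul ENNReal.toReal_nonneg,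
      ENNReal.ofReal_toReal ((π.act H).apply_ne_top a)]

theorem Policy.cost_eq_ofReal (π : Policy N) (h₁ : Fin N.M → ℕ) (K : ℕ) :
    π.cost h₁ K = ENNReal.ofReal (π.mean (K * N.T) (weightedAge h₁ K)) :=
  π.tsum_law_mul _ fun H => mul_nonneg (by positivity) <| Finset.sum_nonneg fun k _ =>
    Finset.sum_nonneg fun i _ => mul_nonneg (N.α_pos i).le (Nat.cast_nonneg _)

/-! ### Deliveries and ages -/

theorem delivered_append {H : History N} {k : ℕ} (hk : (k + 1) * N.T ≤ H.length)
    (H' : History N) (i : Fin N.M) : Delivered (H ++ H') k i ↔ Delivered H k i := by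
  rw [add_mul, one_mul] at hk
  rw [Delivered, Delivered, List.drop_append_of_le_length (by omega),
    List.take_append_of_le_length (by rw [List.length_drop]; omega)]

theorem age_succ_congr {h₁ : Fin N.M → ℕ} {H H' : History N} {k : ℕ} {i : Fin N.M}
    (hd : Delivered H k i ↔ Delivered H' k i) (ha : age h₁ H k i = age h₁ H' k i) :
    age h₁ H (k + 1) i = age h₁ H' (k + 1) i := by
  classical
  rw [age, age, ha]
  exact if_congr hd rfl rfl

theorem age_append (h₁ : Fin N.M → ℕ) {H : History N} {k : ℕ} (hk : k * N.T ≤ H.length)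
    (H' : History N) (i : Fin N.M) : age h₁ (H ++ H') k i = age h₁ H k i := by
  induction k with
  | zero => rfl
  | succ k ih =>
    exact age_succ_congr (delivered_append hk H' i)
      (ih (le_trans (Nat.mul_le_mul_right _ k.le_succ) hk))

theorem delivered_append_singleton {H : History N} {k : ℕ} (h1 : k * N.T ≤ H.length)
    (h2 : H.length < (k + 1) * N.T) (s : Slot N) (i : Fin N.M) :
    Delivered (H ++ [s]) k i ↔ Delivered H k i ∨ s = (some i, true) := by
  rw [add_mul, one_mul] at h2
  rw [Delivered, Delivered, List.drop_append_of_le_length h1,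
    List.take_of_length_le (by simp; omega), List.take_of_length_le (by simp; omega),
    List.mem_append, List.mem_singleton, eq_comm (a := s)]

theorem not_delivered_of_length {H : History N} {k : ℕ} (h : H.length = k * N.T) (i : Fin N.M) :
    ¬ Delivered H k i := by
  simp [Delivered, ← h]

/-! ### The lower bound for all policies -/

-- The potential `(h - 1 - τ)² / 2` grows by exactly `h - τ - 1/2` in a frame without delivery. With
-- a delivery it becomes `τ² / 2`, and the inequality has slack `(h - τ)² / 2`. Thus `τ² / 2` is the
-- price of a delivery for which `τ` is the ideal age at service.
open Classical in
theorem sum_age_ge (h₁ : Fin N.M → ℕ) (H : History N) (i : Fin N.M) (τ : ℝ) (K : ℕ) :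
    K * (τ + 1 / 2) + ((age h₁ H K i : ℝ) - 1 - τ) ^ 2 / 2 ≤
      ∑ k ∈ Finset.range K, (age h₁ H k i : ℝ) + ((h₁ i : ℝ) - 1 - τ) ^ 2 / 2 +
        τ ^ 2 / 2 * ∑ k ∈ Finset.range K, (if Delivered H k i then 1 else 0 : ℝ) := by
  induction K with
  | zero => simp [age]
  | succ K ih =>
    rw [Finset.sum_range_succ, Finset.sum_range_succ, age]
    split_ifs with h
    · push_cast
      nlinarith [sq_nonneg ((age h₁ H K i : ℝ) - τ)]
    · push_cast
      nlinarith

open Classical in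
theorem sum_delivered_le_count (H : History N) (i : Fin N.M) (K : ℕ) :
    ∑ k ∈ Finset.range K, (if Delivered H k i then 1 else 0 : ℝ) ≤ H.count (some i, true) := by
  refine le_trans ?_ (Nat.cast_le.2 ((List.take_sublist (K * N.T) H).count_le _))
  induction K with
  | zero => simp
  | succ K ih =>
    rw [Finset.sum_range_succ, add_mul, one_mul, List.take_add, List.count_append, Nat.cast_add]
    refine add_le_add ih ?_
    split_ifs with h
    · exact Nat.one_le_cast.2 (List.count_pos_iff.2 h)
    · exact Nat.cast_nonneg _

/-- The expected number of transmissions, counted through the deliveries, is at most the number of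
slots. -/
theorem Policy.mean_sum_count_le (π : Policy N) (n : ℕ) :
    π.mean n (fun H => ∑ i, (H.count (some i, true) : ℝ) / N.p i) ≤ n := by
  induction n with
  | zero => simp [mean]
  | succ n ih =>
    rw [π.mean_add n 1, Nat.cast_succ]
    refine le_trans ?_ (add_le_add_left ih 1)
    rw [← π.mean_add_const]
    refine π.mean_mono n fun H _ => ?_
    rw [Function.iterate_one]
    refine π.stepMean_le_of_support fun a _ => ?_
    cases a with
    | none => simp [outcomeMean]
    -- A transmission succeeds with probability `p i` and then adds `1 / p i`: mean increment
    -- exactly one.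
    | some i =>
      have hs : ∑ x, (if i = x then (1 : ℝ) else 0) / N.p x = 1 / N.p i := by
        rw [Finset.sum_eq_single i fun j _ hj => by simp [hj.symm]] <;> simp
      have hp := (N.p_pos i).ne'
      simp only [outcomeMean, List.count_append, List.count_singleton, Nat.cast_add, add_div,
        Finset.sum_add_distrib]
      simp [hs]
      field_simp
      linarith

/-- The long-run cost per frame and client is, for every policy, at least
`((∑ √(α / p))² / T + ∑ α) / (2 M)`. -/
theorem Policy.mean_weightedAge_ge (h₁ : Fin N.M → ℕ) : ∃ c : ℝ, ∀ (π : Policy N) (K : ℕ), 0 < K →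
    ((∑ i, √(N.α i / N.p i)) ^ 2 + N.T * ∑ i, N.α i) / (2 * N.M * N.T) - c / K ≤
      π.mean (K * N.T) (weightedAge h₁ K) := by
  have hM : (0 : ℝ) < N.M := Nat.cast_pos.2 N.M_pos
  have hT : (0 : ℝ) < N.T := Nat.cast_pos.2 N.T_pos
  set S := ∑ i, √(N.α i / N.p i) with hS
  -- Chosen so that the weighted price `α i * τ i ^ 2 / 2` of a delivery is a common constant
  -- divided by `p i` (`hτ2`); the factor `S / T` optimizes the resulting bound.
  set τ : Fin N.M → ℝ := fun i => S / N.T * √(N.α i / N.p i) / N.α i with hτ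
  -- The initial potential does not depend on the policy or on `K`, so the bound survives the
  -- infimum over policies.
  set c := ∑ i, N.α i * (((h₁ i : ℝ) - 1 - τ i) ^ 2 / 2) with hc
  refine ⟨c / N.M, fun π K hK => ?_⟩
  have hK' : (0 : ℝ) < K := Nat.cast_pos.2 hK
  have hτ1 : ∀ i, N.α i * τ i = S / N.T * √(N.α i / N.p i) := fun i => by
    have := (N.α_pos i).ne'
    simp only [hτ]; field_simp
  have hτ2 : ∀ i, N.α i * (τ i ^ 2 / 2) = (S / N.T) ^ 2 / 2 / N.p i := fun i => by
    have h1 := (N.α_pos i).ne'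
    have h2 := (N.p_pos i).ne'
    have h3 : √(N.α i / N.p i) ^ 2 = N.α i / N.p i :=
      Real.sq_sqrt (div_pos (N.α_pos i) (N.p_pos i)).le
    simp only [hτ, div_pow, mul_pow, h3]; field_simp
  have key : ∀ H : History N, K * (S ^ 2 / N.T + (∑ i, N.α i) / 2) ≤
      (K * N.M) * weightedAge h₁ K H +
        (S / N.T) ^ 2 / 2 * ∑ i, (H.count (some i, true) : ℝ) / N.p i + c := fun H => by
    have hw : (K * N.M) * weightedAge h₁ K H =
        ∑ i, N.α i * ∑ k ∈ Finset.range K, (age h₁ H k i : ℝ) := by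
      rw [weightedAge, ← mul_assoc, mul_one_div_cancel (by positivity), one_mul, Finset.sum_comm]
      simp only [Finset.mul_sum]
    have hl : K * (S ^ 2 / N.T + (∑ i, N.α i) / 2) = ∑ i, N.α i * (K * (τ i + 1 / 2)) := by
      have : ∀ i, N.α i * (K * (τ i + 1 / 2)) =
          K * (S / N.T) * √(N.α i / N.p i) + K / 2 * N.α i := fun i => by
        linear_combination K * hτ1 i
      simp only [this, Finset.sum_add_distrib, ← Finset.mul_sum, ← hS]
      ring
    rw [hw, hl, Finset.mul_sum, hc, ← Finset.sum_add_distrib, ← Finset.sum_add_distrib]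
    refine Finset.sum_le_sum fun i _ => ?_
    have h1 := sum_age_ge h₁ H i (τ i) K
    have h2 := mul_le_mul_of_nonneg_left (sum_delivered_le_count H i K)
      (by positivity : 0 ≤ τ i ^ 2 / 2)
    have h3 : (S / N.T) ^ 2 / 2 * ((H.count (some i, true) : ℝ) / N.p i) =
        N.α i * (τ i ^ 2 / 2 * H.count (some i, true)) := by
      rw [← mul_assoc, hτ2]; ring
    rw [h3, ← mul_add, ← mul_add]
    refine mul_le_mul_of_nonneg_left ?_ (N.α_pos i).le
    linarith [sq_nonneg ((age h₁ H K i : ℝ) - 1 - τ i)]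
  have h1 := π.mean_mono (K * N.T) (f := fun _ => K * (S ^ 2 / N.T + (∑ i, N.α i) / 2))
    fun H _ => key H
  rw [π.mean_const, π.mean_add_const, π.mean_add_fun, π.mean_const_mul, π.mean_const_mul] at h1
  have h2 := mul_le_mul_of_nonneg_left (π.mean_sum_count_le (K * N.T))
    (by positivity : 0 ≤ (S / N.T) ^ 2 / 2)
  push_cast at h2
  -- The charge for all slots consumes half of the term `K * S ^ 2 / T`.
  have h3 : (S / N.T) ^ 2 / 2 * (K * N.T) = K * (S ^ 2 / N.T / 2) := by field_simp
  rw [h3] at h2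
  have h4 : (S ^ 2 + N.T * ∑ i, N.α i) / (2 * N.M * N.T) - c / N.M / K =
      (K * (S ^ 2 / N.T / 2 + (∑ i, N.α i) / 2) - c) / (K * N.M) := by
    field_simp
  rw [h4, div_le_iff₀ (by positivity)]
  linarith

/-! ### The drift of Max-Weight -/

/-- Serving the item `i` of the highest value with the first unit of a capacity `r + 1` is at least
as good as the fractional assignment `c`. -/
theorem exists_reduced_weights {ι : Type*} [Fintype ι] [DecidableEq ι] (c v : ι → ℝ) (i : ι) (r : ℕ)
    (h0 : ∀ j, 0 ≤ c j) (h1 : ∀ j, c j ≤ 1) (hs : ∑ j, c j ≤ r + 1)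
    (hv : ∀ j, c j ≠ 0 → v j ≤ v i) (hvi : 0 ≤ v i) :
    ∃ c' : ι → ℝ, (∀ j, 0 ≤ c' j) ∧ (∀ j, c' j ≤ 1) ∧ c' i = 0 ∧ (∀ j, c j = 0 → c' j = 0) ∧
      ∑ j, c' j ≤ r ∧ ∑ j, c j * v j ≤ v i + ∑ j, c' j * v j := by
  have hr : (0 : ℝ) ≤ r := Nat.cast_nonneg r
  have hq : (r : ℝ) ≤ r + 1 - c i := by linarith [h1 i]
  -- Drop `i` and shrink the other weights by `θ` to fit capacity `r`. At most `1 - c i` units are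
  -- lost, each worth at most `v i`, while serving `i` fully gains `(1 - c i) * v i`.
  obtain ⟨θ, hθ0, hθ1, hθ⟩ : ∃ θ : ℝ, 0 ≤ θ ∧ θ ≤ 1 ∧ θ * (r + 1 - c i) = r := by
    rcases (hr.trans hq).eq_or_lt with h | h
    · exact ⟨0, le_rfl, zero_le_one, by linarith⟩
    · exact ⟨r / (r + 1 - c i), div_nonneg hr h.le, (div_le_one h).2 hq, div_mul_cancel₀ _ h.ne'⟩
  set e : ι → ℝ := fun j => if j = i then 0 else c j with he
  have hce : ∀ f : ι → ℝ, ∑ j, c j * f j = c i * f i + ∑ j, e j * f j := fun f => by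
    rw [← Finset.add_sum_erase _ (fun j => c j * f j) (Finset.mem_univ i),
      ← Finset.add_sum_erase _ (fun j => e j * f j) (Finset.mem_univ i)]
    simp only [he, if_true, zero_mul, zero_add]
    congr 1
    exact Finset.sum_congr rfl fun j hj => by rw [if_neg (Finset.ne_of_mem_erase hj)]
  have he0 : ∀ j, 0 ≤ e j := fun j => by simp only [he]; split_ifs <;> simp [h0]
  have he1 : ∀ j, e j ≤ 1 := fun j => by simp only [he]; split_ifs <;> simp [h1]
  have hes : ∑ j, e j ≤ r + 1 - c i := by
    have := hce fun _ => 1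
    simp only [mul_one] at this
    linarith
  refine ⟨fun j => θ * e j, fun j => mul_nonneg hθ0 (he0 j), fun j => mul_le_one₀ hθ1 (he0 j) (he1 j),
    by simp [he], fun j hj => by simp [he, hj], ?_, ?_⟩
  · rw [← Finset.mul_sum, ← hθ]
    exact mul_le_mul_of_nonneg_left hes hθ0
  · have h2 : ∑ j, e j * v j ≤ (r + 1 - c i) * v i := by
      refine le_trans (Finset.sum_le_sum (g := fun j => e j * v i) fun j _ => ?_) ?_
      · by_cases hj : c j = 0
        · simp [he, hj]
        · exact mul_le_mul_of_nonneg_left (hv j hj) (he0 j)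
      · rw [← Finset.sum_mul]
        exact mul_le_mul_of_nonneg_right hes hvi
    have h3 := mul_le_mul_of_nonneg_left h2 (sub_nonneg.2 hθ1)
    have h4 : ∑ j, θ * e j * v j = θ * ∑ j, e j * v j := by
      rw [Finset.mul_sum]; exact Finset.sum_congr rfl fun j _ => mul_assoc _ _ _
    rw [hce, h4]
    have h5 : (1 - θ) * ((r + 1 - c i) * v i) = v i - c i * v i := by
      linear_combination (-v i) * hθ
    linarith

/-- The Lyapunov function: the weighted sum of the squared ages at the beginning of frame `k`. -/
def lyapunov (h₁ : Fin N.M → ℕ) (k : ℕ) (H : History N) : ℝ :=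
  ∑ i, N.α i * (age h₁ H k i : ℝ) ^ 2

theorem lyapunov_append_singleton_of_not_success (h₁ : Fin N.M → ℕ) {k : ℕ} {H : History N}
    (h1 : k * N.T ≤ H.length) (h2 : H.length < (k + 1) * N.T) (a : Option (Fin N.M)) :
    lyapunov h₁ (k + 1) (H ++ [(a, false)]) = lyapunov h₁ (k + 1) H := by
  refine Finset.sum_congr rfl fun i _ => ?_
  have : Delivered (H ++ [(a, false)]) k i ↔ Delivered H k i := by
    simp [delivered_append_singleton h1 h2]
  rw [age_succ_congr this (age_append h₁ h1 _ _)]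

theorem lyapunov_append_singleton_of_success (h₁ : Fin N.M → ℕ) {k : ℕ} {H : History N}
    (h1 : k * N.T ≤ H.length) (h2 : H.length < (k + 1) * N.T) {i : Fin N.M}
    (hi : ¬ Delivered H k i) :
    lyapunov h₁ (k + 1) (H ++ [(some i, true)]) =
      lyapunov h₁ (k + 1) H - N.α i * ((age h₁ H k i : ℝ) * (age h₁ H k i + 2)) := by
  rw [lyapunov, lyapunov, ← Finset.add_sum_erase _ _ (Finset.mem_univ i),
    ← Finset.add_sum_erase _ _ (Finset.mem_univ i)]
  have hi' : Delivered (H ++ [(some i, true)]) k i := by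
    simp [delivered_append_singleton h1 h2]
  have : ∀ j ∈ Finset.univ.erase i, N.α j * (age h₁ (H ++ [(some i, true)]) (k + 1) j : ℝ) ^ 2 =
      N.α j * (age h₁ H (k + 1) j : ℝ) ^ 2 := fun j hj => by
    have : Delivered (H ++ [(some i, true)]) k j ↔ Delivered H k j := by
      simp [delivered_append_singleton h1 h2, (Finset.ne_of_mem_erase hj).symm]
    rw [age_succ_congr this (age_append h₁ h1 _ _)]
  rw [Finset.sum_congr rfl this, age, age, if_pos hi', if_neg hi]
  push_cast
  ring

/-- In the remaining `r` slots of a frame, Max-Weight lowers the Lyapunov function at least as much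
as any fractional assignment of these slots to the clients with undelivered packets. -/
theorem Policy.IsMaxWeight.iterate_stepMean_lyapunov_le {π : Policy N} {h₁ : Fin N.M → ℕ}
    (hπ : π.IsMaxWeight h₁) (k r : ℕ) (H : History N) (hr : r ≤ N.T)
    (hH : H.length + r = (k + 1) * N.T) (c : Fin N.M → ℝ) (h0 : ∀ j, 0 ≤ c j) (h1 : ∀ j, c j ≤ 1)
    (hd : ∀ j, Delivered H k j → c j = 0) (hs : ∑ j, c j ≤ r) :
    π.stepMean^[r] (lyapunov h₁ (k + 1)) H ≤ lyapunov h₁ (k + 1) H -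
      ∑ j, c j * (N.p j * N.α j * (age h₁ H k j : ℝ) * (age h₁ H k j + 2)) := by
  induction r generalizing H c with
  | zero =>
    have hz : ∀ j, c j = 0 := fun j => by
      refine (Finset.sum_eq_zero_iff_of_nonneg fun j _ => h0 j).1
        (le_antisymm (by simpa using hs) (Finset.sum_nonneg fun j _ => h0 j)) j (Finset.mem_univ j)
    simp [hz]
  | succ r ih =>
    have hl1 : k * N.T ≤ H.length := by rw [add_mul, one_mul] at hH; omega
    have hl2 : H.length < (k + 1) * N.T := by omega
    have hdiv : H.length / N.T = k := Nat.div_eq_of_lt_le hl1 hl2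
    have hlen : ∀ s : Slot N, (H ++ [s]).length + r = (k + 1) * N.T := fun s => by
      rw [List.length_append, List.length_singleton]; omega
    have ih' : ∀ (s : Slot N) (c : Fin N.M → ℝ), (∀ j, 0 ≤ c j) → (∀ j, c j ≤ 1) →
        (∀ j, Delivered H k j ∨ s = (some j, true) → c j = 0) → ∑ j, c j ≤ r →
        π.stepMean^[r] (lyapunov h₁ (k + 1)) (H ++ [s]) ≤ lyapunov h₁ (k + 1) (H ++ [s]) -
          ∑ j, c j * (N.p j * N.α j * (age h₁ H k j : ℝ) * (age h₁ H k j + 2)) :=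
      fun s c h0 h1 hd hs => by
        have := ih (H ++ [s]) (by omega) (hlen s) c h0 h1
          (fun j hj => hd j ((delivered_append_singleton hl1 hl2 s j).1 hj)) hs
        simpa only [age_append h₁ hl1] using this
    have hund : ∀ j, Undelivered H j ↔ ¬ Delivered H k j := fun j => by rw [Undelivered, hdiv]
    rw [Function.iterate_succ_apply']
    refine π.stepMean_le_of_support fun a ha => ?_
    cases a with
    | none =>
      -- Idling means that every packet is delivered, so nothing is left to assign.
      have hz : ∀ j, c j = 0 := fun j =>
        hd j (not_not.1 ((hund j).not.1 ((hπ H).2 ha j)))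
      refine (ih' (none, false) c h0 h1 (fun j _ => hz j) (by simp [hz])).trans_eq ?_
      rw [lyapunov_append_singleton_of_not_success h₁ hl1 hl2]
    | some i =>
      have hi : ¬ Delivered H k i := (hund i).1 (π.admissible H i ha)
      have hmax := (hπ H).1 i ha
      simp only [priority, hdiv, hund] at hmax
      have hvi : 0 ≤ N.p i * N.α i * (age h₁ H k i : ℝ) * (age h₁ H k i + 2) := by
        have := N.p_pos i
        have := N.α_pos i
        positivity
      obtain ⟨c', h0', h1', hi', hz', hs', hv'⟩ := exists_reduced_weights c
        (fun j => N.p j * N.α j * (age h₁ H k j : ℝ) * (age h₁ H k j + 2)) i r h0 h1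
        (by exact_mod_cast hs) (fun j hj => hmax j fun h => hj (hd j h)) hvi
      have ht := ih' (some i, true) c' h0' h1' (fun j hj => by
        rcases hj with hj | hj
        · exact hz' j (hd j hj)
        · obtain rfl : i = j := by simpa using hj
          exact hi') hs'
      -- The same `c'` serves after a failure: client `i` is still eligible, but giving it no weight
      -- is allowed. The first slot thus gains `p i * α i * h * (h + 2)` on average, the priority of
      -- `i`.
      have hf := ih' (some i, false) c' h0' h1' (fun j hj => by
        rcases hj with hj | hj
        · exact hz' j (hd j hj)
        · simp at hj) hs'
      rw [lyapunov_append_singleton_of_success h₁ hl1 hl2 hi] at ht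
      rw [lyapunov_append_singleton_of_not_success h₁ hl1 hl2] at hf
      have ht' := mul_le_mul_of_nonneg_left ht (N.p_pos i).le
      have hf' := mul_le_mul_of_nonneg_left hf (sub_nonneg.2 (N.p_le_one i))
      simp only [outcomeMean]
      linarith

/-- The share of the `T` slots of a frame that is assigned to client `i`. -/
def frameShare (N : Network) (i : Fin N.M) : ℝ :=
  N.T * √(N.α i / N.p i) / (∑ j, √(N.α j / N.p j) + (N.T - 1) * √(N.α i / N.p i))

variable (N) in
theorem sqrt_div_pos (i : Fin N.M) : 0 < √(N.α i / N.p i) :=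
  Real.sqrt_pos.2 (div_pos (N.α_pos i) (N.p_pos i))

variable (N) in
theorem sqrt_div_le_sum (i : Fin N.M) : √(N.α i / N.p i) ≤ ∑ j, √(N.α j / N.p j) :=
  Finset.single_le_sum (f := fun j => √(N.α j / N.p j)) (fun _ _ => Real.sqrt_nonneg _)
    (Finset.mem_univ i)

variable (N) in
theorem one_le_cast_T : (1 : ℝ) ≤ N.T := Nat.one_le_cast.2 N.T_pos

theorem frameShare_denom_pos (i : Fin N.M) :
    0 < ∑ j, √(N.α j / N.p j) + (N.T - 1) * √(N.α i / N.p i) :=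
  add_pos_of_pos_of_nonneg ((sqrt_div_pos N i).trans_le (sqrt_div_le_sum N i))
    (mul_nonneg (sub_nonneg.2 (one_le_cast_T N)) (Real.sqrt_nonneg _))

theorem frameShare_pos (i : Fin N.M) : 0 < frameShare N i :=
  div_pos (mul_pos (zero_lt_one.trans_le (one_le_cast_T N)) (sqrt_div_pos N i))
    (frameShare_denom_pos i)

theorem frameShare_le_one (i : Fin N.M) : frameShare N i ≤ 1 := by
  rw [frameShare, div_le_one (frameShare_denom_pos i)]
  linarith [sqrt_div_le_sum N i]

theorem sum_frameShare_le : ∑ i, frameShare N i ≤ N.T := by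
  have : Nonempty (Fin N.M) := ⟨⟨0, N.M_pos⟩⟩
  have hS : 0 < ∑ j, √(N.α j / N.p j) :=
    Finset.sum_pos (fun i _ => sqrt_div_pos N i) Finset.univ_nonempty
  calc ∑ i, frameShare N i
      ≤ ∑ i, N.T * √(N.α i / N.p i) / ∑ j, √(N.α j / N.p j) :=
        Finset.sum_le_sum fun i _ => div_le_div_of_nonneg_left (by positivity) hS
          (le_add_of_nonneg_right
            (mul_nonneg (sub_nonneg.2 (one_le_cast_T N)) (Real.sqrt_nonneg _)))
    _ = N.T := by rw [← Finset.sum_div, ← Finset.mul_sum, mul_div_cancel_right₀ _ hS.ne']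

/-- With `x = s i / S`, the share is `T x / (1 + (T - 1) x)`. Its reciprocal is affine in `1 / x`,
which gives this sum a closed form, while the share stays below both `1` and `T x`. -/
theorem sum_div_frameShare : ∑ i, N.α i / (frameShare N i * N.p i) =
    ((∑ i, √(N.α i / N.p i)) ^ 2 + (N.T - 1) * ∑ i, N.α i / N.p i) / N.T := by
  have hT : (N.T : ℝ) ≠ 0 := (zero_lt_one.trans_le (one_le_cast_T N)).ne'
  have : ∀ i, N.α i / (frameShare N i * N.p i) = ((∑ j, √(N.α j / N.p j)) * √(N.α i / N.p i) +
      (N.T - 1) * (N.α i / N.p i)) / N.T := fun i => by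
    have h2 := (N.p_pos i).ne'
    have h3 := (sqrt_div_pos N i).ne'
    have h4 := (frameShare_denom_pos i).ne'
    have h5 : N.α i = N.p i * √(N.α i / N.p i) ^ 2 := by
      rw [Real.sq_sqrt (div_pos (N.α_pos i) (N.p_pos i)).le, mul_div_cancel₀ _ h2]
    have h6 : N.α i / N.p i = √(N.α i / N.p i) ^ 2 :=
      (Real.sq_sqrt (div_pos (N.α_pos i) (N.p_pos i)).le).symm
    rw [frameShare]
    generalize ∑ j, √(N.α j / N.p j) = S at *
    generalize √(N.α i / N.p i) = s at *
    rw [h6, mul_comm, ← div_div, h6]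
    field_simp
  simp only [this]
  rw [← Finset.sum_div, Finset.sum_add_distrib, ← Finset.mul_sum, ← Finset.mul_sum, sq]

theorem Policy.IsMaxWeight.frame_drift {π : Policy N} {h₁ : Fin N.M → ℕ} (hπ : π.IsMaxWeight h₁)
    (k : ℕ) (H : History N) (hH : H.length = k * N.T) :
    π.stepMean^[N.T] (lyapunov h₁ (k + 1)) H ≤ lyapunov h₁ k H -
      2 * ∑ i, N.α i * (age h₁ H k i : ℝ) + 4 * ∑ i, N.α i / (frameShare N i * N.p i) := by
  refine (hπ.iterate_stepMean_lyapunov_le k N.T H le_rfl (by rw [hH, add_mul, one_mul])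
    (frameShare N) (fun j => (frameShare_pos j).le) frameShare_le_one
    (fun j hj => absurd hj (not_delivered_of_length hH j)) sum_frameShare_le).trans ?_
  rw [lyapunov, lyapunov, Finset.mul_sum, Finset.mul_sum, ← Finset.sum_sub_distrib,
    ← Finset.sum_sub_distrib, ← Finset.sum_add_distrib]
  refine Finset.sum_le_sum fun i _ => ?_
  rw [age, if_neg (not_delivered_of_length hH i)]
  push_cast
  have hα := N.α_pos i
  have hD : 0 < frameShare N i * N.p i := mul_pos (frameShare_pos i) (N.p_pos i)
  have hD1 : frameShare N i * N.p i ≤ 1 :=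
    mul_le_one₀ (frameShare_le_one i) (N.p_pos i).le (N.p_le_one i)
  rw [show frameShare N i * (N.p i * N.α i * (age h₁ H k i : ℝ) * (age h₁ H k i + 2)) =
      N.α i * (frameShare N i * N.p i * (age h₁ H k i * (age h₁ H k i + 2))) by ring]
  generalize frameShare N i * N.p i = D at *
  generalize (age h₁ H k i : ℝ) = x
  -- Tangent bound for `D (x + 1)²`. With `b` in place of `2` the averaged age would be bounded by
  -- `b² / (2 b - 2)` times `∑ α / D`, which is least at `b = 2`. The leftover constant `D - 3` is
  -- negative.
  have h1 : 0 ≤ (D * (x + 1) - 2) ^ 2 / D := by positivity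
  have h2 : (D * (x + 1) - 2) ^ 2 / D = D * (x + 1) ^ 2 - 4 * (x + 1) + 4 / D := by
    field_simp; ring
  have h3 : (x + 1) ^ 2 - D * (x * (x + 2)) ≤ x ^ 2 - 2 * x + 4 / D := by nlinarith
  have h4 := mul_le_mul_of_nonneg_left h3 hα.le
  have h5 : N.α i * (4 / D) = 4 * (N.α i / D) := by ring
  linarith

theorem Policy.IsMaxWeight.mean_lyapunov_le {π : Policy N} {h₁ : Fin N.M → ℕ}
    (hπ : π.IsMaxWeight h₁) (K : ℕ) :
    π.mean (K * N.T) (fun H => lyapunov h₁ K H +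
      2 * ∑ k ∈ Finset.range K, ∑ i, N.α i * (age h₁ H k i : ℝ)) ≤
    lyapunov h₁ 0 [] + K * (4 * ∑ i, N.α i / (frameShare N i * N.p i)) := by
  induction K with
  | zero => simp [mean]
  | succ K ih =>
    rw [add_mul, one_mul, π.mean_add]
    have h1 := add_le_add_left ih (4 * ∑ i, N.α i / (frameShare N i * N.p i))
    rw [← π.mean_add_const] at h1
    refine le_trans (π.mean_mono _ fun H hH => ?_) (h1.trans_eq (by push_cast; ring))
    -- The ages up to the start of frame `K` are settled by the first `K * T` slots, so their sum
    -- leaves the conditional mean.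
    rw [π.iterate_stepMean_add N.T _ _ H fun H' => by
      refine congrArg _ (Finset.sum_congr rfl fun k hk => Finset.sum_congr rfl fun i _ => ?_)
      rw [age_append h₁]
      rw [hH]
      exact Nat.mul_le_mul_right _ (Nat.lt_succ_iff.1 (Finset.mem_range.1 hk)), Finset.sum_range_succ]
    linarith [hπ.frame_drift K H hH]

/-- The long-run cost per frame and client of Max-Weight is at most
`2 ((∑ √(α / p))² + (T - 1) ∑ α / p) / (M T)`. -/
theorem Policy.IsMaxWeight.mean_weightedAge_le {π : Policy N} {h₁ : Fin N.M → ℕ}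
    (hπ : π.IsMaxWeight h₁) (K : ℕ) (hK : 0 < K) :
    π.mean (K * N.T) (weightedAge h₁ K) ≤
      2 * ((∑ i, √(N.α i / N.p i)) ^ 2 + ((N.T : ℝ) - 1) * ∑ i, N.α i / N.p i) / (N.M * N.T) +
        lyapunov h₁ 0 [] / (2 * N.M) / K := by
  have hM : (0 : ℝ) < N.M := Nat.cast_pos.2 N.M_pos
  have hT : (0 : ℝ) < N.T := Nat.cast_pos.2 N.T_pos
  have hK' : (0 : ℝ) < K := Nat.cast_pos.2 hK
  have h1 := hπ.mean_lyapunov_le K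
  rw [sum_div_frameShare] at h1
  have h2 : π.mean (K * N.T) (fun H => 2 * (K * N.M) * weightedAge h₁ K H) ≤ _ :=
    le_trans (π.mean_mono _ fun H _ => ?_) h1
  · rw [π.mean_const_mul, ← le_div_iff₀' (by positivity)] at h2
    refine h2.trans_eq ?_
    field_simp
    ring
  · have h3 : 0 ≤ lyapunov h₁ K H :=
      Finset.sum_nonneg fun i _ => mul_nonneg (N.α_pos i).le (sq_nonneg _)
    have h4 : 2 * (K * N.M) * weightedAge h₁ K H =
        2 * ∑ k ∈ Finset.range K, ∑ i, N.α i * (age h₁ H k i : ℝ) := by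
      rw [weightedAge]; field_simp
    rw [h4]
    linarith

end AoI

/-! ### The asymptotic ratio -/

theorem tendsto_ofReal_add_div_natCast (u a : ℝ) :
    Tendsto (fun K : ℕ => ENNReal.ofReal (u + a / K)) atTop (nhds (ENNReal.ofReal u)) := by
  refine ENNReal.tendsto_ofReal ?_
  simpa using tendsto_const_nhds.add (tendsto_const_div_atTop_nhds_zero_nat a)

/-- Since `l > 0`, division is continuous at the limiting pair. For small `K` the value `l + c / K`
may be negative and is truncated to `0`, which does not affect the limit. -/
theorem limsup_div_le_and_limsup_le {x y : ℕ → ℝ≥0∞} {u a l c : ℝ} (hl : 0 < l) (hu : 0 ≤ u)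
    (hx : ∀ K : ℕ, 0 < K → x K ≤ ENNReal.ofReal (u + a / K))
    (hy : ∀ K : ℕ, 0 < K → ENNReal.ofReal (l + c / K) ≤ y K) :
    limsup (fun K => x K / y K) atTop ≤ ENNReal.ofReal (u / l) ∧
      limsup x atTop ≤ ENNReal.ofReal (u / l) * liminf y atTop := by
  have hl' : ENNReal.ofReal l ≠ 0 := by simpa using hl
  have hX := tendsto_ofReal_add_div_natCast u a
  have hY := tendsto_ofReal_add_div_natCast l c
  constructor
  · rw [ENNReal.ofReal_div_of_pos hl, ← (ENNReal.Tendsto.div hX (.inr hl') hY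
      (.inl ENNReal.ofReal_ne_top)).limsup_eq]
    exact limsup_le_limsup ((eventually_gt_atTop 0).mono fun K hK =>
      ENNReal.div_le_div (hx K hK) (hy K hK))
  · calc limsup x atTop ≤ limsup (fun K : ℕ => ENNReal.ofReal (u + a / K)) atTop :=
          limsup_le_limsup ((eventually_gt_atTop 0).mono hx)
      _ = ENNReal.ofReal (u / l) * ENNReal.ofReal l := by
          rw [hX.limsup_eq, ← ENNReal.ofReal_mul (by positivity), div_mul_cancel₀ _ hl.ne']
      _ ≤ ENNReal.ofReal (u / l) * liminf y atTop := by
          refine mul_le_mul_right ?_ _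
          rw [← hY.liminf_eq]
          exact liminf_le_liminf ((eventually_gt_atTop 0).mono hy)

end

theorem mainTheorem3 (N : AoI.Network) (h₁ : Fin N.M → ℕ) (hh₁ : ∀ i, 1 ≤ h₁ i)
    (π : AoI.Policy N) (hπ : π.IsMaxWeight h₁) :
    π.IsOptimalUpTo h₁
      (4 * ((∑ i, √(N.α i / N.p i)) ^ 2 + ((N.T : ℝ) - 1) * ∑ i, N.α i / N.p i) /
        ((∑ i, √(N.α i / N.p i)) ^ 2 + (N.T : ℝ) * ∑ i, N.α i)) := by
  have hM : (0 : ℝ) < N.M := Nat.cast_pos.2 N.M_pos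
  have hT : (0 : ℝ) < N.T := Nat.cast_pos.2 N.T_pos
  have : Nonempty (Fin N.M) := ⟨⟨0, N.M_pos⟩⟩
  have hα : 0 < ∑ i, N.α i := Finset.sum_pos (fun i _ => N.α_pos i) Finset.univ_nonempty
  have hd : 0 < (∑ i, √(N.α i / N.p i)) ^ 2 + (N.T : ℝ) * ∑ i, N.α i := by positivity
  have hn : 0 ≤ (∑ i, √(N.α i / N.p i)) ^ 2 + ((N.T : ℝ) - 1) * ∑ i, N.α i / N.p i :=
    add_nonneg (sq_nonneg _) (mul_nonneg (sub_nonneg.2 (AoI.one_le_cast_T N))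
      (Finset.sum_nonneg fun i _ => (div_pos (N.α_pos i) (N.p_pos i)).le))
  obtain ⟨c, hc⟩ := AoI.Policy.mean_weightedAge_ge h₁
  have key := limsup_div_le_and_limsup_le (x := fun K => π.cost h₁ K)
    (y := fun K => AoI.optimalCost h₁ K) (c := -c)
    (l := ((∑ i, √(N.α i / N.p i)) ^ 2 + N.T * ∑ i, N.α i) / (2 * N.M * N.T))
    (div_pos hd (by positivity))
    (div_nonneg (mul_nonneg zero_le_two hn) (by positivity : (0 : ℝ) ≤ N.M * N.T))
    (fun K hK => by
      rw [π.cost_eq_ofReal]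
      exact ENNReal.ofReal_le_ofReal (hπ.mean_weightedAge_le K hK))
    (fun K hK => le_iInf fun η => by
      rw [η.cost_eq_ofReal, neg_div, ← sub_eq_add_neg]
      exact ENNReal.ofReal_le_ofReal (hc η K hK))
  -- The factor `4` is the upper bound's `2` over the lower bound's `1/2`.
  have hρ : ∀ a b : ℝ, 0 < b → 2 * a / (N.M * N.T) / (b / (2 * N.M * N.T)) = 4 * a / b :=
    fun a b hb => by field_simp; ring
  rw [hρ _ _ hd] at key
  exact key
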